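/- Let $2^\omega$ be Cantor space with the lexicographic order $<_{lex}$. For $\alpha\in 2^\omega$ let $s_\alpha:2^\omega\to\{0,1\}$ be the step function with $s_\alpha(x)=0$ if $x<_{lex}\alpha$ and $s_\alpha(x)=1$ if $x\geq_{lex}\alpha$. For partial multi-valued functions $f,g$ between represented spaces, write $f\leq_W g$ ($f$ is Weihrauch reducible to $g$) if there are computable partial functions $H,K$ on Baire space $\omega^\omega$ such that for every realizer $G$ of $g$ the partial function $p\mapsto K\langle p,G(H(p))\rangle$ is a realizer of $f$. Here $2^\omega$ is represented by its inclusion in $\omega^\omega$, and a name of $b\in\{0,1\}$ is any $p\in\omega^\omega$ with $p(0)=b$. Write $f\mid_W g$ if neither $f\leq_W g$ nor $g\leq_W f$. **Proposition.** There exist computably enumerable sets $A,B\subseteq\omega$ such that $$A\equiv_1 B\quad\text{and}\quad s_\alpha\mid_W s_\beta,$$ where $\alpha=\chi_A$ and $\beta=\chi_B$ are the characteristic functions of $A$ and $B$, and $A\equiv_1 B$ means that each of $A$ and $B$ is one-one reducible to the other via a total computable injection. -/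

import Mathlib

namespace StepWeihrauch

/-- Baire space, the space of names. -/
abbrev Baire : Type := ℕ → ℕ

/-- Cantor space, with `false` for the bit 0 and `true` for the bit 1. -/
abbrev Cantor : Type := ℕ → Bool

/-- The finite initial segment of length `k` of `p`. -/
def initSeg (p : Baire) (k : ℕ) : List ℕ := (List.range k).map p

/-- A partial function `F` on Baire space is computable if there is a computable function `φ` on
finite words, monotone for the prefix order, such that for every `p` in the domain of `F` the words
`φ (initSeg p k)` are initial segments of `F p` whose lengths tend to infinity with `k`.
(By monotonicity it is enough to ask that each entry of `F p` is produced at some `k`.) -/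
def ComputableFunctional (F : Baire →. Baire) : Prop :=
  ∃ φ : List ℕ → List ℕ, Computable φ ∧
    (∀ u v : List ℕ, u <+: v → φ u <+: φ v) ∧
    ∀ p q : Baire, q ∈ F p → ∀ n : ℕ, ∃ k : ℕ, (φ (initSeg p k))[n]? = some (q n)

/-- The pairing `⟨p, q⟩ = (p 0, q 0, p 1, q 1, …)` on Baire space. -/
def pairing (p q : Baire) : Baire := fun n => if n % 2 = 0 then p (n / 2) else q (n / 2)

/-- A represented space: a set with a partial surjection from Baire space onto it. -/
class Represented (X : Type*) where
  rep : Baire →. X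
  rep_surjective : ∀ x : X, ∃ p : Baire, x ∈ rep p

/-- The names of points of Cantor space are the 0-1-sequences. -/
instance : Represented Cantor where
  rep p := ⟨∀ n, p n < 2, fun _ n => decide (p n = 1)⟩
  rep_surjective x := by
    refine ⟨fun n => (x n).toNat, fun n => Bool.toNat_lt _, ?_⟩
    funext n
    cases h : x n <;> simp [h]

/-- The names of a bit `b` are the sequences whose entry at position 0 is `b`. -/
instance : Represented Bool where
  rep p := ⟨p 0 < 2, fun _ => decide (p 0 = 1)⟩
  rep_surjective b := by
    refine ⟨fun _ => b.toNat, Bool.toNat_lt _, ?_⟩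
    cases b <;> simp

/-- A problem: a partial multi-valued function, given by its set of solutions at each point.
Its domain is the set of points at which there is a solution. -/
abbrev Problem (X Y : Type*) : Type _ := X → Set Y

/-- A total single-valued function as a problem. -/
def Problem.ofFun {X Y : Type*} (f : X → Y) : Problem X Y := fun x => {f x}

/-- `F` realizes `f`: it maps every name of a point in the domain of `f` to a name of a solution. -/
def Realizes {X Y : Type*} [Represented X] [Represented Y] (F : Baire →. Baire)
    (f : Problem X Y) : Prop :=
  ∀ (p : Baire) (x : X), x ∈ Represented.rep p → (f x).Nonempty →
    ∃ q ∈ F p, ∃ y ∈ f x, y ∈ (Represented.rep q : Part Y)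

/-- Weihrauch reducibility of `f` to `g`: there are computable partial functions `H`
(pre-processing) and `K` (post-processing) on Baire space such that for every realizer `G` of `g`
the partial function `p ↦ K ⟨p, G (H p)⟩` realizes `f`. -/
def WeihrauchLE {X Y Z W : Type*} [Represented X] [Represented Y] [Represented Z] [Represented W]
    (f : Problem X Y) (g : Problem Z W) : Prop :=
  ∃ H K : Baire →. Baire, ComputableFunctional H ∧ ComputableFunctional K ∧
    ∀ G : Baire →. Baire, Realizes G g →
      Realizes (fun p => (H p).bind fun q => (G q).bind fun r => K (pairing p r)) f

/-- Weihrauch incomparability. -/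
def WeihrauchIncomparable {X Y Z W : Type*} [Represented X] [Represented Y] [Represented Z]
    [Represented W] (f : Problem X Y) (g : Problem Z W) : Prop :=
  ¬ WeihrauchLE f g ∧ ¬ WeihrauchLE g f

open Classical in
/-- The step function with threshold `α`: 0 at `x` strictly below `α` in the lexicographic order,
and 1 at `x` at or above `α`. -/
noncomputable def step (α : Cantor) : Cantor → Bool :=
  fun x => if toLex x < toLex α then false else true

open Classical in
/-- The characteristic function of a set of natural numbers, as a point of Cantor space. -/
noncomputable def chi (A : Set ℕ) : Cantor := fun n => decide (n ∈ A)

end StepWeihrauch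

/-!
Call `A_b`, for a bit `b`, the two sets to be built, `α_b` their characteristic functions. Positions
are grouped in blocks `{2n, 2n+1}`. A block has the contents `00` on both sides, or `10` on one side
and `01` on the other, so that exchanging the positions within each block is a one-one equivalence
between the two sets.

If `s_α ≤_W s_β` and `α` has infinitely many bits `1`, then `s_α` is discontinuous from below at
`α`. So the pre-processing is a total continuous functional `h` on Cantor space with `h α = β`, and
it maps the points below `α` and close enough to `α` to points below `β`
(`exists_tracks_of_step_le`). This is excluded by using one block `n` for each such functional: let
`σ` and `τ` be the contents of the earlier blocks on the side of `α` and of `β`. If some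
`x` extending `σ01` has a value extending `τ1`, block `n` becomes `10` in `α` and `01` in `β`, and
then `x < α` but `β < h x`. Otherwise it becomes `01` in `α` and `10` in `β`, and `h α ≠ β`
(`Tracks.exists_lt`). By compactness the alternative can be decided once the program for `h` has
been seen to give long enough output on all words of some length; a requirement whose program does
so is said to converge (`Converges`).

The decision needs the true state of the earlier blocks, which depends on which of the other
requirements converge. Injuries are avoided by guessing: block `n` codes by its binary digits a
finite set of requirements with maximum `Nat.log 2 n`, works for that maximum, and leaves the state
`00` once all requirements in its set have been seen to converge. The block deciding its state may
then assume that exactly the requirements in its set converge, so that an earlier block `m` has left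
the state `00` if and only if its set is contained in that of `n`; hence the state of block `n` is
computed from least witnesses of convergence alone (`blockState`), and the two sets are recursively
enumerable (`rePred_sideSet`). For each converging `k`, the block whose set consists of the
converging requirements up to `k` has guessed right (`exists_block`).
-/

namespace StepWeihrauch

open Nat.Partrec (Code)
open Encodable Denumerable

/-! ### The construction -/

/-- All 0-1-words of length `u`. -/
def binaryWords : ℕ → List (List ℕ)
  | 0 => [[]]
  | u + 1 => (binaryWords u).flatMap fun z => [z ++ [0], z ++ [1]]

/-- The word computed from the word `z` by the program `c` within `t` steps, and the empty word if
there is none. -/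
def output (c : Code) (t : ℕ) (z : List ℕ) : List ℕ :=
  ((c.evaln t (encode z)).bind fun y => (decode y : Option (List ℕ))).getD []

/-- The side of the `k`-th requirement: which of the two sequences is the argument. -/
def side (k : ℕ) : Bool := k.unpair.1.bodd

/-- The program of the `k`-th requirement. The component `k.unpair.2.unpair.2` is free, so that each
program belongs to requirements with arbitrarily late blocks. -/
def code (k : ℕ) : Code := ofNat Code k.unpair.2.unpair.1

/-- The number of output bits requirement `k` waits for. It exceeds `2 * n + 1` for every block
`n < 2 ^ (k + 1)`. -/
def bound (k : ℕ) : ℕ := 2 * 2 ^ (k + 1)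

/-- `w` codes a word length `u` and a step bound `t` such that the program of requirement `k`
gives long output within `t` steps on all 0-1-words of length `u`. -/
def Witness (k w : ℕ) : Prop :=
  bound k ≤ w.unpair.1 ∧
    ∀ z ∈ binaryWords w.unpair.1, bound k ≤ (output (code k) w.unpair.2 z).length

instance (k w : ℕ) : Decidable (Witness k w) := by unfold Witness; infer_instance

/-- The contents, on side `b`, of a block in the given state. -/
def blockBits (b : Bool) : Option Bool → List ℕ
  | none => [0, 0]
  | some d => if (d ^^ b) = true then [1, 0] else [0, 1]

/-- The contents, on side `b`, of consecutive blocks in the given states. -/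
def blockWord (b : Bool) (q : List (Option Bool)) : List ℕ := q.flatMap (blockBits b)

/-- Some 0-1-word that continues the contents of the blocks `q` by `01` on the side of
requirement `k` is mapped to a word that continues their contents on the other side by `1`. -/
def Hits (k w : ℕ) (q : List (Option Bool)) : Prop :=
  ∃ z ∈ binaryWords w.unpair.1, blockWord (side k) q ++ [0, 1] <+: z ∧
    blockWord (!side k) q ++ [1] <+: output (code k) w.unpair.2 z

instance (k w : ℕ) (q : List (Option Bool)) : Decidable (Hits k w q) := by
  unfold Hits; infer_instance

/-- The state chosen for the block following the blocks `q`: on the side of requirement `k` its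
contents are `10` if `Hits k w q`, and `01` otherwise. -/
def decision (k w : ℕ) (q : List (Option Bool)) : Bool := decide (Hits k w q) ^^ side k

/-- `j` belongs to the finite set coded by `n`: the binary digits of `n` together with the leading
position (which matters only for `n = 0`). -/
def Guesses (n j : ℕ) : Prop := j = Nat.log 2 n ∨ n.testBit j = true

instance (n j : ℕ) : Decidable (Guesses n j) := by unfold Guesses; infer_instance

/-- The finite set coded by `m` is contained in the one coded by `n`. -/
def GuessSubset (m n : ℕ) : Prop := ∀ j < m + 1, Guesses m j → Guesses n j

instance (m n : ℕ) : Decidable (GuessSubset m n) := by unfold GuessSubset; infer_instance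

/-- The state given to block `n` once all requirements it guesses to converge have been seen to
converge, with witnesses `w`. -/
def blockState (w : ℕ → ℕ) (n : ℕ) : Bool :=
  decision (Nat.log 2 n) (w (Nat.log 2 n))
    ((List.finRange n).map fun m : Fin n =>
      if GuessSubset m n then some (blockState w m) else none)
termination_by n
decreasing_by exact m.2

theorem blockState_eq (w : ℕ → ℕ) (n : ℕ) :
    blockState w n = decision (Nat.log 2 n) (w (Nat.log 2 n))
      ((List.range n).map fun m => if GuessSubset m n then some (blockState w m) else none) := by
  rw [blockState, ← List.map_coe_finRange_eq_range, List.map_map]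
  rfl

/-! ### Computability of the construction -/

section Computability

variable {α : Type*} [Primcodable α]

theorem primrecRel_forall_lt {R : ℕ → α → Prop} (hR : PrimrecRel R) :
    PrimrecRel fun (n : ℕ) (a : α) => ∀ i < n, R i a :=
  (hR.forall_mem_list.comp (Primrec.list_range.comp Primrec.fst) Primrec.snd).of_eq
    fun _ => by simp

theorem primrec_two_pow : Primrec fun n : ℕ => 2 ^ n := by
  refine (Primrec.nat_rec₁ (f := fun _ y => 2 * y) 1
    (Primrec.nat_mul.comp (Primrec.const 2) Primrec.snd)).of_eq fun n => ?_
  induction n with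
  | zero => rfl
  | succ n ih => simp only [ih, pow_succ]; ring

theorem primrecRel_testBit : PrimrecRel fun n j : ℕ => n.testBit j = true := by
  refine PrimrecRel.of_eq (r := fun n j => n / 2 ^ j % 2 = 1) ?_ fun n j => ?_
  · exact Primrec.eq.comp (Primrec.nat_mod.comp (Primrec.nat_div.comp Primrec.fst
      (primrec_two_pow.comp Primrec.snd)) (Primrec.const 2)) (Primrec.const 1)
  · simp [Nat.testBit_eq_decide_div_mod_eq]

theorem primrec_log_two : Primrec (Nat.log 2) := by
  refine (Primrec.nat_findGreatest (f := fun n : ℕ => n) (p := fun n j => 2 ^ j ≤ n) Primrec.id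
    (Primrec.nat_le.comp (primrec_two_pow.comp Primrec.snd) Primrec.fst)).of_eq fun n => ?_
  rcases Nat.eq_zero_or_pos n with rfl | hn
  · simp
  · rw [Nat.findGreatest_eq_iff]
    refine ⟨Nat.log_le_self 2 n, fun _ => Nat.pow_log_le_self 2 hn.ne', fun j hj _ => ?_⟩
    exact not_le.2 (Nat.lt_pow_of_log_lt one_lt_two hj)

theorem primrecRel_isPrefix [DecidableEq α] : PrimrecRel fun u v : List α => u <+: v :=
  PrimrecRel.of_eq (r := fun u v => u = v.take u.length)
    (Primrec.eq.comp Primrec.fst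
      (Primrec.list_take.comp (Primrec.list_length.comp Primrec.fst) Primrec.snd))
    fun _ _ => List.prefix_iff_eq_take.symm

theorem primrec_binaryWords : Primrec binaryWords := by
  refine (Primrec.nat_rec₁ (f := fun _ l => l.flatMap fun z : List ℕ => [z ++ [0], z ++ [1]]) [[]]
    ?_).of_eq fun n => ?_
  · refine Primrec.list_flatMap Primrec.snd ?_
    exact Primrec.list_cons.comp (Primrec.list_concat.comp Primrec.snd (Primrec.const 0))
      (Primrec.list_cons.comp (Primrec.list_concat.comp Primrec.snd (Primrec.const 1))
        (Primrec.const []))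
  · induction n with
    | zero => rfl
    | succ n ih => simp only [ih, binaryWords]

theorem primrec_output :
    Primrec fun a : (Code × ℕ) × List ℕ => output a.1.1 a.1.2 a.2 := by
  unfold output
  refine Primrec.option_getD.comp (Primrec.option_bind ?_ ?_) (Primrec.const [])
  · exact Code.primrec_evaln.comp (((Primrec.snd.comp Primrec.fst).pair
      (Primrec.fst.comp Primrec.fst)).pair (Primrec.encode.comp Primrec.snd))
  · exact Primrec.decode.comp Primrec.snd

theorem primrec_side : Primrec side :=
  Primrec.nat_bodd.comp (Primrec.fst.comp Primrec.unpair)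

theorem primrec_code : Primrec code :=
  (Primrec.ofNat Code).comp
    (Primrec.fst.comp (Primrec.unpair.comp (Primrec.snd.comp Primrec.unpair)))

theorem primrec_bound : Primrec bound :=
  Primrec.nat_mul.comp (Primrec.const 2) (primrec_two_pow.comp Primrec.succ)

theorem primrec_output_code : Primrec₂ fun (z : List ℕ) (a : ℕ × ℕ) =>
    output (code a.1) a.2.unpair.2 z :=
  primrec_output.comp (((primrec_code.comp (Primrec.fst.comp Primrec.snd)).pair
    (Primrec.snd.comp (Primrec.unpair.comp (Primrec.snd.comp Primrec.snd)))).pair Primrec.fst)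

theorem primrecRel_witness : PrimrecRel Witness := by
  have h : PrimrecRel fun (z : List ℕ) (a : ℕ × ℕ) =>
      bound a.1 ≤ (output (code a.1) a.2.unpair.2 z).length :=
    Primrec.nat_le.comp (primrec_bound.comp (Primrec.fst.comp Primrec.snd))
      (Primrec.list_length.comp primrec_output_code)
  have hu : Primrec fun a : ℕ × ℕ => a.2.unpair.1 :=
    Primrec.fst.comp (Primrec.unpair.comp Primrec.snd)
  exact (Primrec.nat_le.comp (primrec_bound.comp Primrec.fst) hu).and
    (h.forall_mem_list.comp (primrec_binaryWords.comp hu) Primrec.id)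

theorem primrec_blockWord : Primrec₂ blockWord := by
  have h : Primrec₂ blockBits := Primrec.dom_finite (α := Bool × Option Bool) _
  exact Primrec.list_flatMap Primrec.snd (h.comp (Primrec.fst.comp Primrec.fst) Primrec.snd)

theorem primrec_decision :
    Primrec fun a : (ℕ × ℕ) × List (Option Bool) => decision a.1.1 a.1.2 a.2 := by
  have hk : Primrec fun p : List ℕ × ((ℕ × ℕ) × List (Option Bool)) => side p.2.1.1 :=
    primrec_side.comp (Primrec.fst.comp (Primrec.fst.comp Primrec.snd))
  have hq : Primrec fun p : List ℕ × ((ℕ × ℕ) × List (Option Bool)) => p.2.2 :=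
    Primrec.snd.comp Primrec.snd
  have h : PrimrecRel fun (z : List ℕ) (a : (ℕ × ℕ) × List (Option Bool)) =>
      blockWord (side a.1.1) a.2 ++ [0, 1] <+: z ∧
        blockWord (!side a.1.1) a.2 ++ [1] <+: output (code a.1.1) a.1.2.unpair.2 z :=
    (primrecRel_isPrefix.comp (Primrec.list_append.comp (primrec_blockWord.comp hk hq)
      (Primrec.const [0, 1])) Primrec.fst).and
    (primrecRel_isPrefix.comp (Primrec.list_append.comp
      (primrec_blockWord.comp (Primrec.not.comp hk) hq) (Primrec.const [1]))
      (primrec_output_code.comp Primrec.fst (Primrec.fst.comp Primrec.snd)))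
  have h' : PrimrecPred fun a : (ℕ × ℕ) × List (Option Bool) => Hits a.1.1 a.1.2 a.2 :=
    h.exists_mem_list.comp (primrec_binaryWords.comp
      (Primrec.fst.comp (Primrec.unpair.comp (Primrec.snd.comp Primrec.fst)))) Primrec.id
  exact (Primrec.dom_bool₂ xor).comp h'.decide
    (primrec_side.comp (Primrec.fst.comp Primrec.fst))

theorem primrecRel_guesses : PrimrecRel Guesses :=
  (Primrec.eq.comp Primrec.snd (primrec_log_two.comp Primrec.fst)).or primrecRel_testBit

theorem primrecRel_guessSubset : PrimrecRel GuessSubset := by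
  have h : PrimrecRel fun (j : ℕ) (a : ℕ × ℕ) => Guesses a.1 j → Guesses a.2 j := by
    refine PrimrecRel.of_eq (r := fun (j : ℕ) (a : ℕ × ℕ) => ¬ Guesses a.1 j ∨ Guesses a.2 j)
      ?_ fun _ _ => imp_iff_not_or.symm
    exact (primrecRel_guesses.comp (Primrec.fst.comp Primrec.snd) Primrec.fst).not.or
      (primrecRel_guesses.comp (Primrec.snd.comp Primrec.snd) Primrec.fst)
  have h' := primrecRel_forall_lt h
  exact h'.comp (f := fun p : ℕ × ℕ => p.1 + 1) (g := fun p => p)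
    (Primrec.succ.comp Primrec.fst) Primrec.id

/-- The course-of-values step for `blockState`: the state of the block following blocks of
states `s`, of which only those with smaller guess sets are consulted. -/
def nextState (W : List ℕ) (s : List Bool) : Bool :=
  decision (Nat.log 2 s.length) (W.getD (Nat.log 2 s.length) 0)
    ((List.range s.length).map fun m => if GuessSubset m s.length then s[m]? else none)

theorem primrec_restrict_guessSubset : Primrec fun p : List ℕ × List Bool =>
    (List.range p.2.length).map fun m => if GuessSubset m p.2.length then p.2[m]? else none := by
  have hs : Primrec fun p : List ℕ × List Bool => p.2.length :=
    Primrec.list_length.comp Primrec.snd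
  refine Primrec.list_map (Primrec.list_range.comp hs) ?_
  exact Primrec.ite (primrecRel_guessSubset.comp Primrec.snd (hs.comp Primrec.fst))
    (Primrec.list_getElem?.comp (Primrec.snd.comp Primrec.fst) Primrec.snd) (Primrec.const none)

theorem primrec_nextState : Primrec₂ nextState := by
  have hl : Primrec fun p : List ℕ × List Bool => Nat.log 2 p.2.length :=
    primrec_log_two.comp (Primrec.list_length.comp Primrec.snd)
  have h := primrec_decision.comp ((hl.pair ((Primrec.list_getD 0).comp Primrec.fst hl)).pair
    primrec_restrict_guessSubset)
  exact h

theorem nextState_map_range (W : List ℕ) (n : ℕ) :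
    nextState W ((List.range n).map (blockState fun j => W.getD j 0)) =
      blockState (fun j => W.getD j 0) n := by
  rw [blockState_eq, nextState]
  simp only [List.length_map, List.length_range]
  congr 1
  refine List.map_congr_left fun m hm => ?_
  simp [List.mem_range.1 hm]

theorem primrec_blockState :
    Primrec₂ fun (W : List ℕ) (n : ℕ) => blockState (fun j => W.getD j 0) n :=
  Primrec.nat_strong_rec (fun (W : List ℕ) (n : ℕ) => blockState (fun j => W.getD j 0) n)
    (Primrec.option_some.comp₂ primrec_nextState) fun W n => by
      rw [nextState_map_range]

/-- `W` lists the least witnesses of the requirements that block `n` guesses to converge. -/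
def Verifies (W : List ℕ) (n : ℕ) : Prop :=
  ∀ j < n + 1, Guesses n j →
    Witness j (W.getD j 0) ∧ ∀ v < W.getD j 0, ¬ Witness j v

/-- The set on side `b`: block `a / 2` has left the state `00`, and its contents on side `b`, as
given by `blockBits`, have the bit 1 at position `a`. -/
def sideSet (b : Bool) : Set ℕ :=
  {a | ∃ W : List ℕ, Verifies W (a / 2) ∧
    (blockState (fun j => W.getD j 0) (a / 2) ^^ (b ^^ a.bodd)) = true}

theorem primrecRel_verifies : PrimrecRel Verifies := by
  have hW : Primrec fun p : ℕ × (List ℕ × ℕ) => p.2.1.getD p.1 0 :=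
    (Primrec.list_getD 0).comp (Primrec.fst.comp Primrec.snd) Primrec.fst
  have hl : PrimrecRel fun (k w : ℕ) => ∀ v < w, ¬ Witness k v := by
    have : PrimrecRel fun (v k : ℕ) => ¬ Witness k v := primrecRel_witness.swap.not
    exact this.forall_lt.swap
  have h : PrimrecRel fun (j : ℕ) (a : List ℕ × ℕ) => Guesses a.2 j →
      Witness j (a.1.getD j 0) ∧ ∀ v < a.1.getD j 0, ¬ Witness j v := by
    refine PrimrecRel.of_eq (r := fun (j : ℕ) (a : List ℕ × ℕ) => ¬ Guesses a.2 j ∨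
      (Witness j (a.1.getD j 0) ∧ ∀ v < a.1.getD j 0, ¬ Witness j v))
      ?_ fun _ _ => imp_iff_not_or.symm
    exact (primrecRel_guesses.comp (Primrec.snd.comp Primrec.snd) Primrec.fst).not.or
      ((primrecRel_witness.comp Primrec.fst hW).and (hl.comp Primrec.fst hW))
  have h' := primrecRel_forall_lt h
  exact h'.comp (f := fun p : List ℕ × ℕ => p.2 + 1) (g := fun p => p)
    (Primrec.succ.comp Primrec.snd) Primrec.id

/-- A projection of a primitive recursive relation is recursively enumerable. -/
theorem rePred_exists {β : Type*} [Primcodable β] {R : β → α → Prop} (hR : PrimrecRel R) :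
    REPred fun a => ∃ b, R b a := by
  classical
  have h : Computable₂ fun (a : α) (i : ℕ) =>
      ((decode i : Option β).map fun b => decide (R b a)).getD false := by
    refine Primrec.to_comp (Primrec.option_getD.comp (Primrec.option_map
      (Primrec.decode.comp Primrec.snd) ?_) (Primrec.const false))
    exact hR.decide.comp Primrec.snd (Primrec.fst.comp Primrec.fst)
  refine (Partrec.rfind h.partrec₂).dom_re.of_eq fun a => ?_
  rw [Nat.rfind_dom]
  constructor
  · rintro ⟨i, hi, -⟩
    cases hd : (decode i : Option β) with
    | none => simp [hd] at hi
    | some b => exact ⟨b, by simpa [hd] using hi⟩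
  · rintro ⟨b, hb⟩
    exact ⟨encode b, by simpa using hb, fun _ => trivial⟩

theorem rePred_sideSet (b : Bool) : REPred fun a => a ∈ sideSet b := by
  have ha : Primrec fun p : List ℕ × ℕ => p.2 / 2 :=
    Primrec.nat_div.comp Primrec.snd (Primrec.const 2)
  refine rePred_exists (R := fun (W : List ℕ) (a : ℕ) => Verifies W (a / 2) ∧
    (blockState (fun j => W.getD j 0) (a / 2) ^^ (b ^^ a.bodd)) = true) ?_
  exact (primrecRel_verifies.comp Primrec.fst ha).and (Primrec.eq.comp
    ((Primrec.dom_bool₂ xor).comp (primrec_blockState.comp Primrec.fst ha)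
      ((Primrec.dom_bool₂ xor).comp (Primrec.const b) (Primrec.nat_bodd.comp Primrec.snd)))
    (Primrec.const true))

/-- Exchange of the two positions of each block. -/
def blockSwap (a : ℕ) : ℕ := 2 * (a / 2) + (1 - a % 2)

theorem computable_blockSwap : Computable blockSwap :=
  (Primrec.nat_add.comp (Primrec.nat_mul.comp (Primrec.const 2)
    (Primrec.nat_div.comp Primrec.id (Primrec.const 2))) (Primrec.nat_sub.comp (Primrec.const 1)
    (Primrec.nat_mod.comp Primrec.id (Primrec.const 2)))).to_comp

theorem oneOneReducible_sideSet (b : Bool) :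
    OneOneReducible (fun a => a ∈ sideSet b) (fun a => a ∈ sideSet (!b)) := by
  refine ⟨blockSwap, computable_blockSwap, fun a c h => ?_, fun a => ?_⟩
  · unfold blockSwap at h; omega
  · have h2 : blockSwap a / 2 = a / 2 := by unfold blockSwap; omega
    have hb : (blockSwap a).bodd = !a.bodd := by
      have := Nat.mod_two_of_bodd a
      have := Nat.mod_two_of_bodd (blockSwap a)
      have : blockSwap a % 2 = 1 - a % 2 := by unfold blockSwap; omega
      cases h : a.bodd <;> cases h' : (blockSwap a).bodd <;> simp_all
    have hx : ((!b) ^^ (!a.bodd)) = (b ^^ a.bodd) := by cases b <;> cases a.bodd <;> rfl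
    simp only [sideSet, Set.mem_ofPred_eq, h2, hb, hx]

end Computability

/-! ### Initial segments -/

theorem initSeg_length (p : Baire) (k : ℕ) : (initSeg p k).length = k := by simp [initSeg]

theorem initSeg_succ (p : Baire) (k : ℕ) : initSeg p (k + 1) = initSeg p k ++ [p k] := by
  simp [initSeg, List.range_succ]

theorem initSeg_getElem? (p : Baire) {k i : ℕ} (h : i < k) : (initSeg p k)[i]? = some (p i) := by
  simp [initSeg, h]

theorem initSeg_congr {p q : Baire} {k : ℕ} (h : ∀ i < k, p i = q i) :
    initSeg p k = initSeg q k :=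
  List.map_congr_left fun i hi => h i (List.mem_range.1 hi)

theorem initSeg_prefix (p : Baire) {k l : ℕ} (h : k ≤ l) : initSeg p k <+: initSeg p l := by
  induction l, h using Nat.le_induction with
  | base => exact List.prefix_rfl
  | succ l _ ih => exact ih.trans (initSeg_succ p l ▸ List.prefix_append _ _)

theorem getElem?_of_prefix {α : Type*} {u v : List α} (h : u <+: v) {n : ℕ}
    (hn : n < u.length) : u[n]? = v[n]? := by
  obtain ⟨t, rfl⟩ := h
  exact (List.getElem?_append_left hn).symm

theorem eq_of_initSeg_prefix {p q : Baire} {k l : ℕ} (h : initSeg p k <+: initSeg q l)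
    {i : ℕ} (hi : i < k) : p i = q i := by
  have hkl : k ≤ l := by simpa [initSeg_length] using h.length_le
  have h1 := getElem?_of_prefix h (n := i) (by simpa [initSeg_length] using hi)
  rw [initSeg_getElem? p hi, initSeg_getElem? q (hi.trans_le hkl)] at h1
  exact Option.some.inj h1

theorem eq_of_append_prefix {p q : Baire} {k l c : ℕ} {v : List ℕ}
    (h : initSeg p k ++ c :: v <+: initSeg q l) : q k = c := by
  have hkl := h.length_le
  simp only [List.length_append, initSeg_length, List.length_cons] at hkl
  have h1 := getElem?_of_prefix h (n := k) (by simp [initSeg_length])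
  rw [initSeg_getElem? q (by omega), List.getElem?_append_right (by rw [initSeg_length]),
    initSeg_length, Nat.sub_self] at h1
  exact (Option.some.inj h1).symm

/-- The unique name of a point of Cantor space. -/
def name (x : Cantor) : Baire := fun n => (x n).toNat

theorem name_inj {x y : Cantor} {i : ℕ} : name x i = name y i ↔ x i = y i :=
  ⟨fun h => by revert h; cases hx : x i <;> cases hy : y i <;> simp [name, hx, hy],
    fun h => congrArg Bool.toNat h⟩

theorem mem_binaryWords {u : ℕ} {z : List ℕ} :
    z ∈ binaryWords u ↔ ∃ x : Cantor, z = initSeg (name x) u := by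
  induction u generalizing z with
  | zero => simp [binaryWords, initSeg]
  | succ u ih =>
    simp only [binaryWords, List.mem_flatMap]
    constructor
    · rintro ⟨z', hz', hz⟩
      obtain ⟨x, rfl⟩ := ih.1 hz'
      have key : ∀ c : Bool, initSeg (name x) u ++ [c.toNat] =
          initSeg (name (Function.update x u c)) (u + 1) := fun c => by
        rw [initSeg_succ, initSeg_congr (p := name (Function.update x u c)) (q := name x)]
        · simp [name]
        · intro i hi
          simp [name, Function.update_of_ne hi.ne]
      simp only [List.mem_cons, List.not_mem_nil, or_false] at hz
      rcases hz with rfl | rfl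
      · exact ⟨_, key false⟩
      · exact ⟨_, key true⟩
    · rintro ⟨x, rfl⟩
      refine ⟨_, ih.2 ⟨x, rfl⟩, ?_⟩
      rw [initSeg_succ]
      cases h : x u <;> simp [name, h]

/-! ### The states of the blocks -/

theorem guesses_lt {n j : ℕ} (h : Guesses n j) : j < n + 1 := by
  rcases h with rfl | h
  · exact Nat.lt_succ_of_le (Nat.log_le_self 2 n)
  · exact (Nat.lt_two_pow_self.trans_le (Nat.ge_two_pow_of_testBit h)).trans (Nat.lt_succ_self n)

theorem guessSubset_iff {m n : ℕ} : GuessSubset m n ↔ ∀ j, Guesses m j → Guesses n j :=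
  ⟨fun h j hj => h j (guesses_lt hj) hj, fun h j _ hj => h j hj⟩

/-- The state of a block depends only on the witnesses of the requirements it guesses to
converge. -/
theorem blockState_congr {w w' : ℕ → ℕ} (n : ℕ) (h : ∀ j, Guesses n j → w j = w' j) :
    blockState w n = blockState w' n := by
  induction n using Nat.strong_induction_on with
  | _ n ih =>
    rw [blockState_eq, blockState_eq w', h _ (Or.inl rfl)]
    congr 1
    refine List.map_congr_left fun m hm => ?_
    split_ifs with hs
    · rw [ih m (List.mem_range.1 hm) fun j hj => h j (guessSubset_iff.1 hs j hj)]
    · rfl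

/-- The program of requirement `k` gives long enough output on all words of some length. -/
def Converges (k : ℕ) : Prop := ∃ w, Witness k w

/-- The least witness for the convergence of requirement `k`, if there is one. -/
noncomputable def leastWitness (k : ℕ) : ℕ := sInf {w | Witness k w}

theorem Converges.witness {k : ℕ} (h : Converges k) : Witness k (leastWitness k) :=
  Nat.sInf_mem h

theorem eq_leastWitness {k w : ℕ} (h : Witness k w) (h' : ∀ v < w, ¬ Witness k v) :
    w = leastWitness k :=
  le_antisymm (not_lt.1 fun hl => h' _ hl (Converges.witness ⟨w, h⟩)) (Nat.sInf_le h)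

open Classical in
/-- The final state of block `n`. -/
noncomputable def state (n : ℕ) : Option Bool :=
  if ∀ j, Guesses n j → Converges j then some (blockState leastWitness n) else none

theorem state_of_forall {n : ℕ} (h : ∀ j, Guesses n j → Converges j) :
    state n = some (blockState leastWitness n) := if_pos h

theorem mem_sideSet_iff {b : Bool} {a : ℕ} :
    a ∈ sideSet b ↔ ∃ d, state (a / 2) = some d ∧ (d ^^ (b ^^ a.bodd)) = true := by
  constructor
  · rintro ⟨W, hW, ha⟩
    refine ⟨_, state_of_forall fun j hj => ⟨_, (hW j (guesses_lt hj) hj).1⟩, ?_⟩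
    rwa [← blockState_congr (a / 2)
      fun j hj => eq_leastWitness (hW j (guesses_lt hj) hj).1 (hW j (guesses_lt hj) hj).2]
  · rintro ⟨d, hd, ha⟩
    unfold state at hd
    split_ifs at hd with h
    obtain rfl := Option.some.inj hd
    have hW : ∀ j, Guesses (a / 2) j →
        ((List.range (a / 2 + 1)).map leastWitness).getD j 0 = leastWitness j := fun j hj => by
      have := guesses_lt hj
      simp [List.getD, this]
    refine ⟨(List.range (a / 2 + 1)).map leastWitness, fun j _ hj => ?_, ?_⟩
    · rw [hW j hj]
      exact ⟨(h j hj).witness, fun v hv hv' => Nat.notMem_of_lt_sInf hv hv'⟩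
    · rwa [blockState_congr (a / 2) hW]

/-- The characteristic function of the set on side `b`. -/
noncomputable def sidePoint (b : Bool) : Cantor := chi (sideSet b)

theorem sidePoint_eq_true_iff {b : Bool} {a : ℕ} : sidePoint b a = true ↔ a ∈ sideSet b := by
  simp [sidePoint, chi]

theorem name_sidePoint (b : Bool) (n : ℕ) :
    [name (sidePoint b) (2 * n), name (sidePoint b) (2 * n + 1)] = blockBits b (state n) := by
  have h0 : sidePoint b (2 * n) = true ↔ ∃ d, state n = some d ∧ (d ^^ b) = true := by
    rw [sidePoint_eq_true_iff, mem_sideSet_iff]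
    simp
  have h1 : sidePoint b (2 * n + 1) = true ↔ ∃ d, state n = some d ∧ (d ^^ !b) = true := by
    rw [sidePoint_eq_true_iff, mem_sideSet_iff, show (2 * n + 1) / 2 = n by omega]
    simp
  cases hs : state n with
  | none => simp_all [blockBits, name]
  | some d => cases b <;> cases d <;> simp_all [blockBits, name]

theorem initSeg_sidePoint (b : Bool) (n : ℕ) :
    initSeg (name (sidePoint b)) (2 * n) = blockWord b ((List.range n).map state) := by
  induction n with
  | zero => rfl
  | succ n ih =>
    rw [show 2 * (n + 1) = 2 * n + 1 + 1 by ring, initSeg_succ, initSeg_succ, ih,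
      List.append_assoc, List.singleton_append, name_sidePoint, List.range_succ]
    simp [blockWord]

/-- For a converging requirement `k`, the block that guesses exactly which requirements up to `k`
converge receives its state from the true states of all earlier blocks. -/
theorem exists_block {k : ℕ} (hk : Converges k) :
    ∃ n, k ≤ n ∧ n < 2 ^ (k + 1) ∧
      state n = some (decision k (leastWitness k) ((List.range n).map state)) := by
  classical
  set n := Nat.ofBits fun i : Fin (k + 1) => decide (Converges i) with hn
  have hlt : n < 2 ^ (k + 1) := Nat.ofBits_lt_two_pow _
  have hbit : ∀ j, n.testBit j = true ↔ j ≤ k ∧ Converges j := fun j => by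
    rcases lt_or_ge j (k + 1) with h | h
    · rw [hn, Nat.testBit_ofBits_lt _ _ h]
      simp [Nat.lt_succ_iff.1 h]
    · rw [hn, Nat.testBit_ofBits_ge _ _ h]
      simp only [Bool.false_eq_true, false_iff]
      omega
  have hle : 2 ^ k ≤ n := Nat.ge_two_pow_of_testBit ((hbit k).2 ⟨le_rfl, hk⟩)
  have hlog : Nat.log 2 n = k :=
    (Nat.log_eq_iff (Or.inr ⟨one_lt_two, by have := Nat.two_pow_pos k; omega⟩)).2 ⟨hle, hlt⟩
  have hguess : ∀ j, Guesses n j ↔ j ≤ k ∧ Converges j := fun j => by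
    rw [Guesses, hbit, hlog]
    exact ⟨fun h => h.elim (fun h => ⟨h.le, h ▸ hk⟩) id, Or.inr⟩
  refine ⟨n, Nat.lt_two_pow_self.le.trans hle, hlt, ?_⟩
  rw [state_of_forall fun j hj => ((hguess j).1 hj).2, blockState_eq, hlog]
  congr 2
  refine List.map_congr_left fun m hm => ?_
  have hm : m < n := List.mem_range.1 hm
  have hmk : ∀ j, Guesses m j → j ≤ k := by
    rintro j (rfl | h)
    · exact hlog ▸ Nat.log_mono_right hm.le
    · have := (Nat.ge_two_pow_of_testBit h).trans_lt (hm.trans hlt)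
      exact Nat.lt_succ_iff.1 ((Nat.pow_lt_pow_iff_right one_lt_two).1 this)
  have hiff : GuessSubset m n ↔ ∀ j, Guesses m j → Converges j := by
    rw [guessSubset_iff]
    exact forall₂_congr fun j hj => by simp [hguess, hmk j hj]
  simp only [state, hiff]

/-! ### Functionals on Cantor space and their programs -/

/-- The monotone word function `φ` describes the function `h` on Cantor space. -/
structure Tracks (φ : List ℕ → List ℕ) (h : Cantor → Cantor) : Prop where
  mono : ∀ u v : List ℕ, u <+: v → φ u <+: φ v
  spec : ∀ x n, ∃ k, (φ (initSeg (name x) k))[n]? = some (name (h x) n)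

theorem Tracks.getElem? {φ : List ℕ → List ℕ} {h : Cantor → Cantor} (H : Tracks φ h) (x : Cantor)
    {k n : ℕ} (hn : n < (φ (initSeg (name x) k)).length) :
    (φ (initSeg (name x) k))[n]? = some (name (h x) n) := by
  obtain ⟨l, hl⟩ := H.spec x n
  rcases le_total k l with hkl | hlk
  · rw [← hl]
    exact getElem?_of_prefix (H.mono _ _ (initSeg_prefix _ hkl)) hn
  · rw [← hl]
    have hn' : n < (φ (initSeg (name x) l)).length := (List.getElem?_eq_some_iff.1 hl).1
    exact (getElem?_of_prefix (H.mono _ _ (initSeg_prefix _ hlk)) hn').symm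

theorem Tracks.eq_initSeg {φ : List ℕ → List ℕ} {h : Cantor → Cantor} (H : Tracks φ h)
    (x : Cantor) (k : ℕ) :
    φ (initSeg (name x) k) = initSeg (name (h x)) (φ (initSeg (name x) k)).length := by
  refine List.ext_getElem? fun n => ?_
  rcases lt_or_ge n (φ (initSeg (name x) k)).length with hn | hn
  · rw [H.getElem? x hn, initSeg_getElem? _ hn]
  · rw [List.getElem?_eq_none hn, List.getElem?_eq_none (by rwa [initSeg_length])]

theorem Tracks.exists_length_ge {φ : List ℕ → List ℕ} {h : Cantor → Cantor} (H : Tracks φ h)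
    (x : Cantor) (N : ℕ) : ∃ k, N ≤ (φ (initSeg (name x) k)).length := by
  obtain ⟨k, hk⟩ := H.spec x N
  exact ⟨k, (List.getElem?_eq_some_iff.1 hk).1.le⟩

theorem isOpen_setOf_initSeg (P : List ℕ → Prop) (k : ℕ) :
    IsOpen {x : Cantor | P (initSeg (name x) k)} := by
  refine isOpen_iff_forall_mem_open.2 fun x hx => ⟨PiNat.cylinder x k, fun y hy => ?_,
    PiNat.isOpen_cylinder _ _ _, PiNat.self_mem_cylinder _ _⟩
  have : initSeg (name y) k = initSeg (name x) k :=
    initSeg_congr fun i hi => name_inj.2 (hy i hi)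
  simpa only [Set.mem_ofPred_eq, this] using hx

/-- By compactness of Cantor space, the use of finitely many output bits is bounded uniformly in
the argument. -/
theorem Tracks.exists_uniform {φ : List ℕ → List ℕ} {h : Cantor → Cantor} (H : Tracks φ h)
    (N : ℕ) : ∃ u, N ≤ u ∧ ∀ x, N ≤ (φ (initSeg (name x) u)).length := by
  have hmono : ∀ x {k l : ℕ}, k ≤ l →
      (φ (initSeg (name x) k)).length ≤ (φ (initSeg (name x) l)).length :=
    fun x k l hkl => (H.mono _ _ (initSeg_prefix _ hkl)).length_le
  obtain ⟨u, hu⟩ := (isCompact_univ (X := Cantor)).elim_directed_cover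
    (fun k => {x : Cantor | N ≤ (φ (initSeg (name x) k)).length})
    (fun k => isOpen_setOf_initSeg (fun z => N ≤ (φ z).length) k)
    (fun x _ => Set.mem_iUnion.2 (H.exists_length_ge x N))
    (directed_of_isDirected_le fun k l hkl x hx => le_trans hx (hmono x hkl))
  exact ⟨max N u, le_max_left _ _,
    fun x => le_trans (hu (Set.mem_univ x)) (hmono x (le_max_right _ _))⟩

theorem exists_code_of_computable {φ : List ℕ → List ℕ} (hφ : Computable φ) :
    ∃ c : Code, ∀ z, c.eval (encode z) = Part.some (encode (φ z)) := by
  obtain ⟨c, hc⟩ := Code.exists_code.1 hφ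
  refine ⟨c, fun z => ?_⟩
  rw [hc]
  simp

theorem output_eq_or {c : Code} {φ : List ℕ → List ℕ}
    (hc : ∀ z, c.eval (encode z) = Part.some (encode (φ z))) (t : ℕ) (z : List ℕ) :
    output c t z = [] ∨ output c t z = φ z := by
  unfold output
  cases h : c.evaln t (encode z) with
  | none => exact Or.inl rfl
  | some y =>
    have hy := Code.evaln_sound (Option.mem_def.2 h)
    rw [hc, Part.mem_some_iff] at hy
    exact Or.inr (by simp [hy])

theorem exists_output_eq {c : Code} {φ : List ℕ → List ℕ}
    (hc : ∀ z, c.eval (encode z) = Part.some (encode (φ z))) (l : List (List ℕ)) :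
    ∃ t, ∀ z ∈ l, output c t z = φ z := by
  have h : ∀ z, ∃ t, ∀ s ≥ t, output c s z = φ z := fun z => by
    obtain ⟨t, ht⟩ := Code.evaln_complete.1 (hc z ▸ Part.mem_some (encode (φ z)))
    refine ⟨t, fun s hs => ?_⟩
    have := Option.mem_def.1 (Code.evaln_mono hs ht)
    simp [output, this]
  choose t ht using h
  exact ⟨(l.map t).sum, fun z hz => ht z _ (List.le_sum_of_mem (List.mem_map_of_mem hz))⟩

/-- Each program describing a total functional on Cantor space belongs to arbitrarily late
converging requirements on either side. -/
theorem Tracks.exists_converges {φ : List ℕ → List ℕ} {h : Cantor → Cantor} (H : Tracks φ h)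
    {c : Code} (hc : ∀ z, c.eval (encode z) = Part.some (encode (φ z))) (b : Bool) (m : ℕ) :
    ∃ k, m ≤ k ∧ side k = b ∧ code k = c ∧ Converges k := by
  set k := Nat.pair b.toNat (Nat.pair (encode c) m) with hk
  have hcode : code k = c := by simp [code, hk]
  refine ⟨k, (Nat.right_le_pair _ _).trans (Nat.right_le_pair _ _), ?_, hcode, ?_⟩
  · cases b <;> simp [side, hk]
  · obtain ⟨u, hu, hlen⟩ := H.exists_uniform (bound k)
    obtain ⟨t, ht⟩ := exists_output_eq hc (binaryWords u)
    refine ⟨Nat.pair u t, ?_⟩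
    simp only [Witness, Nat.unpair_pair, hcode]
    refine ⟨hu, fun z hz => ?_⟩
    obtain ⟨x, rfl⟩ := mem_binaryWords.1 hz
    rw [ht _ hz]
    exact hlen x

/-! ### The requirements are met -/

theorem lex_lt_iff {x y : Cantor} :
    toLex x < toLex y ↔ ∃ i, (∀ j < i, x j = y j) ∧ x i < y i := Iff.rfl

/-- If any functional is total on Cantor space, then both points have infinitely many bits `1`, as
infinitely many requirements converge. -/
theorem Tracks.exists_mem_sideSet {φ : List ℕ → List ℕ} {h : Cantor → Cantor} (H : Tracks φ h)
    (hφ : Computable φ) (b : Bool) (m : ℕ) : ∃ a, m ≤ a ∧ sidePoint b a = true := by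
  obtain ⟨c, hc⟩ := exists_code_of_computable hφ
  obtain ⟨k, hmk, -, -, hk⟩ := H.exists_converges hc b m
  obtain ⟨n, hkn, -, hn⟩ := exists_block hk
  have hb := name_sidePoint b n
  rw [hn] at hb
  rcases hd : (decision k (leastWitness k) ((List.range n).map state) ^^ b) with _ | _
  · have : sidePoint b (2 * n) = false ∧ sidePoint b (2 * n + 1) = true := by
      simpa [blockBits, hd, name] using hb
    exact ⟨2 * n + 1, by omega, this.2⟩
  · have : sidePoint b (2 * n) = true ∧ sidePoint b (2 * n + 1) = false := by
      simpa [blockBits, hd, name] using hb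
    exact ⟨2 * n, by omega, this.1⟩

/-- A functional that maps the point on side `b` to the other one does not map all smaller
arguments close to it to smaller values. -/
theorem Tracks.exists_lt {φ : List ℕ → List ℕ} {h : Cantor → Cantor} (H : Tracks φ h)
    (hφ : Computable φ) {b : Bool} (hb : h (sidePoint b) = sidePoint (!b)) (m : ℕ) :
    ∃ x, (∀ i < m, x i = sidePoint b i) ∧ toLex x < toLex (sidePoint b) ∧
      toLex (sidePoint (!b)) < toLex (h x) := by
  obtain ⟨c, hc⟩ := exists_code_of_computable hφ
  obtain ⟨k, hmk, rfl, rfl, hk⟩ := H.exists_converges hc b m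
  obtain ⟨n, hkn, hn, hs⟩ := exists_block hk
  obtain ⟨hu, hlen⟩ := hk.witness
  have hbound : 2 * n + 2 ≤ bound k := by unfold bound; omega
  have h1 := name_sidePoint (side k) n
  have h2 := name_sidePoint (!side k) n
  rw [hs, decision] at h1 h2
  -- In the first case any point extending the word found is the `x` sought; in the second case
  -- the point on side `b` itself would provide such a word.
  by_cases hit : Hits k (leastWitness k) ((List.range n).map state)
  · obtain ⟨z, hz, hz1, hz2⟩ := id hit
    obtain ⟨x, rfl⟩ := mem_binaryWords.1 hz
    rw [← initSeg_sidePoint] at hz1 hz2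
    have hout : output (code k) (leastWitness k).unpair.2
        (initSeg (name x) (leastWitness k).unpair.1) =
        φ (initSeg (name x) (leastWitness k).unpair.1) :=
      (output_eq_or hc _ _).resolve_left fun h0 => by simp [h0] at hz2
    rw [hout, H.eq_initSeg x] at hz2
    have h1' : sidePoint (side k) (2 * n) = true := by
      simpa [hit, blockBits, name] using congrArg List.head? h1
    have h2' : sidePoint (!side k) (2 * n) = false := by
      simpa [hit, blockBits, name] using congrArg List.head? h2
    have e1 : ∀ i < 2 * n, x i = sidePoint (side k) i := fun i hi =>
      (name_inj.1 (eq_of_initSeg_prefix ((List.prefix_append _ _).trans hz1) hi)).symm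
    have e2 : ∀ i < 2 * n, sidePoint (!side k) i = h x i := fun i hi =>
      name_inj.1 (eq_of_initSeg_prefix ((List.prefix_append _ _).trans hz2) hi)
    have e3 : x (2 * n) = false := by
      simpa [name] using eq_of_append_prefix hz1
    have e4 : h x (2 * n) = true := by
      simpa [name] using eq_of_append_prefix hz2
    refine ⟨x, fun i hi => e1 i (by omega), lex_lt_iff.2 ⟨2 * n, e1, ?_⟩,
      lex_lt_iff.2 ⟨2 * n, e2, ?_⟩⟩
    · rw [e3, h1']; decide
    · rw [e4, h2']; decide
  · refine absurd ⟨_, mem_binaryWords.2 ⟨sidePoint (side k), rfl⟩, ?_, ?_⟩ hit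
    · have h1' : [name (sidePoint (side k)) (2 * n), name (sidePoint (side k)) (2 * n + 1)] =
          [0, 1] := by simpa [hit, blockBits] using h1
      rw [← initSeg_sidePoint, ← h1', ← List.singleton_append, ← List.append_assoc, ← initSeg_succ,
        ← initSeg_succ]
      exact initSeg_prefix _ (hbound.trans hu)
    · have hl := hlen _ (mem_binaryWords.2 ⟨sidePoint (side k), rfl⟩)
      have hout := (output_eq_or hc (leastWitness k).unpair.2
        (initSeg (name (sidePoint (side k))) (leastWitness k).unpair.1)).resolve_left
        fun h0 => by rw [h0] at hl; simp only [List.length_nil] at hl; omega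
      have h2' : name (sidePoint (!side k)) (2 * n) = 1 := by
        simpa [hit, blockBits] using congrArg List.head? h2
      rw [hout] at hl ⊢
      rw [← initSeg_sidePoint, H.eq_initSeg, hb, ← h2', ← initSeg_succ]
      exact initSeg_prefix _ (by omega)

/-! ### Reductions between step functions -/

theorem mem_rep_cantor {p : Baire} {x : Cantor} :
    x ∈ (Represented.rep p : Part Cantor) ↔ (∀ n, p n < 2) ∧ ∀ n, x n = decide (p n = 1) :=
  ⟨fun ⟨hp, h⟩ => ⟨hp, fun n => (congrFun h n).symm⟩,
    fun ⟨hp, h⟩ => ⟨hp, funext fun n => (h n).symm⟩⟩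

theorem mem_rep_bool {p : Baire} {c : Bool} :
    c ∈ (Represented.rep p : Part Bool) ↔ p 0 < 2 ∧ c = decide (p 0 = 1) :=
  ⟨fun ⟨hp, h⟩ => ⟨hp, h.symm⟩, fun ⟨hp, h⟩ => ⟨hp, h.symm⟩⟩

theorem mem_rep_name (x : Cantor) : x ∈ (Represented.rep (name x) : Part Cantor) :=
  mem_rep_cantor.2 ⟨fun n => Bool.toNat_lt _, fun n => by cases h : x n <;> simp [name, h]⟩

theorem name_of_mem_rep {p : Baire} {x : Cantor} (h : x ∈ (Represented.rep p : Part Cantor)) :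
    name x = p := by
  obtain ⟨hp, hx⟩ := mem_rep_cantor.1 h
  funext n
  have h01 : p n = 0 ∨ p n = 1 := by have := hp n; omega
  rcases h01 with h | h <;> simp [name, hx, h]

theorem eq_toNat_of_mem_rep {p : Baire} {c : Bool} (h : c ∈ (Represented.rep p : Part Bool)) :
    p 0 = c.toNat := by
  obtain ⟨hp, rfl⟩ := mem_rep_bool.1 h
  have h01 : p 0 = 0 ∨ p 0 = 1 := by omega
  rcases h01 with h | h <;> simp [h]

/-- The realizer of a function from Cantor space to the bits that is undefined outside the names
of points and takes constant sequences as values. -/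
def constRealizer (f : Cantor → Bool) : Baire →. Baire := fun p =>
  (Represented.rep p : Part Cantor).map fun x _ => (f x).toNat

theorem realizes_constRealizer (f : Cantor → Bool) :
    Realizes (constRealizer f) (Problem.ofFun f) := by
  intro p x hx _
  refine ⟨fun _ => (f x).toNat, Part.mem_map _ hx, f x, rfl, Bool.toNat_lt _, ?_⟩
  cases f x <;> rfl

/-- A reduction between functions from Cantor space to the bits consists of a continuous
pre-processing `h` and of a post-processing that reads only finitely many bits of the argument. -/
theorem WeihrauchLE.exists_tracks {f g : Cantor → Bool}
    (hfg : WeihrauchLE (Problem.ofFun f) (Problem.ofFun g)) :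
    ∃ φ h, Computable φ ∧ Tracks φ h ∧
      ∀ x, ∃ k, ∀ y, (∀ i < k, y i = x i) → g (h y) = g (h x) → f y = f x := by
  obtain ⟨H, K, ⟨φ, hφ, hφmono, hH⟩, ⟨ψ, -, hψmono, hK⟩, hred⟩ := hfg
  have key : ∀ x, ∃ y, name y ∈ H (name x) ∧
      ∃ q ∈ K (pairing (name x) fun _ => (g y).toNat), q 0 = (f x).toNat := fun x => by
    obtain ⟨q, hq, c, hc, hqc⟩ := hred _ (realizes_constRealizer g) (name x) x (mem_rep_name x)
      ⟨f x, rfl⟩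
    obtain ⟨p, hp, hq⟩ := Part.mem_bind_iff.1 hq
    obtain ⟨r, hr, hq⟩ := Part.mem_bind_iff.1 hq
    obtain ⟨y, hy, rfl⟩ := (Part.mem_map_iff _).1 hr
    obtain rfl : c = f x := hc
    exact ⟨y, (name_of_mem_rep hy).symm ▸ hp, q, hq, eq_toNat_of_mem_rep hqc⟩
  choose h hh r hr hr0 using key
  refine ⟨φ, h, hφ, ⟨hφmono, fun x n => hH _ _ (hh x) n⟩, fun x => ?_⟩
  obtain ⟨k, hk⟩ := hK _ _ (hr x) 0
  refine ⟨k, fun y hy hgy => ?_⟩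
  obtain ⟨l, hl⟩ := hK _ _ (hr y) 0
  -- The words read from the two arguments agree up to `k`, so that the first output bits agree.
  have hseg : initSeg (pairing (name x) fun _ => (g (h x)).toNat) k =
      initSeg (pairing (name y) fun _ => (g (h y)).toNat) k := by
    refine initSeg_congr fun i hi => ?_
    simp only [pairing, hgy]
    rw [name_inj.2 (hy (i / 2) (by omega))]
  rw [hseg] at hk
  have hlen := (List.getElem?_eq_some_iff.1 hk).1
  have hlen' := (List.getElem?_eq_some_iff.1 hl).1
  have heq : r x 0 = r y 0 := by
    refine Option.some.inj (hk.symm.trans (Eq.trans ?_ hl))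
    rcases le_total k l with hkl | hlk
    · exact getElem?_of_prefix (hψmono _ _ (initSeg_prefix _ hkl)) hlen
    · exact (getElem?_of_prefix (hψmono _ _ (initSeg_prefix _ hlk)) hlen').symm
  rw [hr0, hr0] at heq
  cases hx : f x <;> cases hy : f y <;> simp_all

theorem step_eq_false_iff {α x : Cantor} : step α x = false ↔ toLex x < toLex α := by
  simp [step]

theorem step_self (α : Cantor) : step α α = true := by
  rw [← Bool.not_eq_false, step_eq_false_iff]
  exact lt_irrefl _

/-- `step α` depends only on finitely many bits of an argument other than `α`. -/
theorem step_congr {α x y : Cantor} {i : ℕ} (hi : x i ≠ α i) (hxy : ∀ j ≤ i, x j = y j) :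
    step α x = step α y := by
  have key : ∀ {u v : Cantor}, u i ≠ α i → (∀ j ≤ i, u j = v j) → toLex u < toLex α →
      toLex v < toLex α := by
    rintro u v hu huv ⟨n, hn, hlt⟩
    have hni : n ≤ i := not_lt.1 fun h => hu (hn i h)
    refine lex_lt_iff.2 ⟨n, fun j hj => ?_, ?_⟩
    · rw [← huv j (hj.le.trans hni)]
      exact hn j hj
    · rw [← huv n hni]
      exact hlt
  have : step α x = false ↔ step α y = false := by
    rw [step_eq_false_iff, step_eq_false_iff]
    exact ⟨key hi hxy, key (hxy i le_rfl ▸ hi) fun j hj => (hxy j hj).symm⟩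
  cases hx : step α x <;> cases hy : step α y <;> simp_all

/-- As `step α` is discontinuous from below at `α` if `α` has infinitely many bits `1`, a reduction
to `step β` must map `α` to `β`, and smaller points near `α` to smaller points than `β`. -/
theorem exists_tracks_of_step_le {α β : Cantor}
    (hred : WeihrauchLE (Problem.ofFun (step α)) (Problem.ofFun (step β))) :
    ∃ φ h, Computable φ ∧ Tracks φ h ∧ ((∀ m, ∃ a, m ≤ a ∧ α a = true) →
      h α = β ∧ ∃ m, ∀ x, (∀ i < m, x i = α i) → toLex x < toLex α → toLex (h x) < toLex β) := by
  obtain ⟨φ, h, hφ, H, hK⟩ := hred.exists_tracks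
  refine ⟨φ, h, hφ, H, fun hinf => ?_⟩
  obtain ⟨k, hk⟩ := hK α
  have hne : ∀ x, (∀ i < k, x i = α i) → toLex x < toLex α → step β (h x) ≠ step β (h α) := by
    intro x hx hlt heq
    have := hk x hx heq
    rw [step_self, step_eq_false_iff.2 hlt] at this
    exact Bool.false_ne_true this
  have hα : h α = β := by
    by_contra hαβ
    obtain ⟨i, hi⟩ := Function.ne_iff.1 hαβ
    obtain ⟨l, hl⟩ := H.exists_length_ge α (i + 1)
    obtain ⟨a, ha, hαa⟩ := hinf (max k l)
    -- Deleting a late bit `1` of `α` gives a smaller point whose value still differs from `β` at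
    -- the same place.
    have hx : ∀ j < a, Function.update α a false j = α j := fun j hj =>
      Function.update_of_ne hj.ne _ _
    have hseg : initSeg (name (Function.update α a false)) l = initSeg (name α) l :=
      initSeg_congr fun j hj => name_inj.2 (hx j (by omega))
    have hval : ∀ j ≤ i, h α j = h (Function.update α a false) j := fun j hj => by
      have h1 := H.getElem? α (k := l) (n := j) (by omega)
      have h2 := H.getElem? (Function.update α a false) (k := l) (n := j)
        (by rw [hseg]; omega)
      rw [hseg, h1] at h2
      exact name_inj.1 (Option.some.inj h2)
    exact hne (Function.update α a false) (fun j hj => hx j (by omega))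
      ⟨a, hx, by simp [hαa]⟩ (step_congr hi hval).symm
  refine ⟨hα, k, fun x hx hlt => ?_⟩
  have := hne x hx hlt
  rw [hα, step_self] at this
  exact step_eq_false_iff.1 (by simpa using this)

theorem not_step_sidePoint_le (b : Bool) :
    ¬ WeihrauchLE (Problem.ofFun (step (sidePoint b))) (Problem.ofFun (step (sidePoint !b))) := by
  intro hred
  obtain ⟨φ, h, hφ, H, hh⟩ := exists_tracks_of_step_le hred
  obtain ⟨hb, m, hm⟩ := hh (H.exists_mem_sideSet hφ b)
  obtain ⟨x, hx, hlt, hgt⟩ := H.exists_lt hφ hb m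
  exact (hm x hx hlt).asymm hgt

end StepWeihrauch

theorem mainTheorem6 :
    ∃ A B : Set ℕ,
      REPred (fun n : ℕ => n ∈ A) ∧ REPred (fun n : ℕ => n ∈ B) ∧
      OneOneEquiv (fun n : ℕ => n ∈ A) (fun n : ℕ => n ∈ B) ∧
      StepWeihrauch.WeihrauchIncomparable
        (StepWeihrauch.Problem.ofFun (StepWeihrauch.step (StepWeihrauch.chi A)))
        (StepWeihrauch.Problem.ofFun (StepWeihrauch.step (StepWeihrauch.chi B))) :=
  ⟨StepWeihrauch.sideSet false, StepWeihrauch.sideSet true,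
    StepWeihrauch.rePred_sideSet false, StepWeihrauch.rePred_sideSet true,
    ⟨StepWeihrauch.oneOneReducible_sideSet false, StepWeihrauch.oneOneReducible_sideSet true⟩,
    StepWeihrauch.not_step_sidePoint_le false, StepWeihrauch.not_step_sidePoint_le true⟩
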